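/- All logarithms and information measures are to base $2$. Let $\mathcal U,\mathcal X,\mathcal Y,\mathcal V,\mathcal Z$ be finite alphabets of sizes $J,K,L,M,s$, let $\ell\ge 1$, and let $n\ge 1$ be a multiple of $\ell$. A deterministic sequence $\mathbf u=(u_1,u_2,\ldots)$ over $\mathcal U$ is mapped by an arbitrary deterministic encoder to $\mathbf x=(x_1,x_2,\ldots)$ over $\mathcal X$, which is sent over a discrete memoryless channel $P(y|x)$ of capacity $C$ with output $Y_1,Y_2,\ldots$ in $\mathcal Y$. A decoder with state set $\mathcal Z$, a modulo-$\ell$ counter and delay $d\ge 0$ starts from a fixed state $z_1$ and computes, with $\tau=t \bmod \ell$, $$V_{t-d}=f_\tau(z_t,Y_t)\quad (t>d),\qquad z_{t+1}=g_\tau(z_t,Y_t)\quad (t\ge 1);$$ the last $d$ symbols of $V_1,\ldots,V_n$ (all $n$ of them if $d\ge n$), not yet produced at time $n$, are arbitrary (possibly random) elements of $\mathcal V$. Probabilities and expectations refer to the randomness of the channel. Let $\rho:\mathcal U\times\mathcal V\to[0,\infty)$ be a distortion measure and $\rho_{\max}=\max_{u,v}\rho(u,v)$. Let $U^\ell$ be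 distributed according to the empirical distribution of the $n/\ell$ non-overlapping blocks $u_{i\ell+1}^{i\ell+\ell}$, $0\le i<n/\ell$, let $\hat H$ and $\hat{\mathbf E}$ be entropy and expectation under this distribution, and for $R\ge 0$ put $$\tilde D_{U^\ell}(R)=\min_{q}\Big\{\tfrac1\ell\hat{\mathbf E}\rho(U^\ell,q(U^\ell)):\ \hat H(q(U^\ell))\le \ell R\Big\},$$ where $q$ ranges over the maps $\mathcal U^\ell\to\mathcal V^\ell$ and $\rho$ is extended additively to blocks. Let $\Delta(\varepsilon)=h_2(\varepsilon)+\varepsilon\ell\log J$, with $h_2$ the binary entropy function, and $$\delta_1(\ell,n)=\frac{(JK)^\ell\log L}{\sqrt n}+\frac{(JKL)^\ell\log e}{2n}+r(n),$$ $$\delta_2(\ell,n)=\delta_1(\ell,n)+\frac{2\ell(1+\log J)^2}{(1-\eta_n)\log n}+\frac{2\ell J^{2\ell}\log J}{n}+\frac1\ell,$$ where $\eta_n>0$ is any sequence tending to zero, with $\eta_n<1$ at the $n$ considered (for $n=1$ the term with $\log n$ in the denominator is read as $0$). Theorem. Given $\mathcal U,\mathcal X,\mathcal Y$ and $\ell$,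 there is a function $r(n)\ge 0$ with $r(n)=o(1/\sqrt n)$ as $n\to\infty$ such that the following holds for all the remaining objects above. If $q:\mathcal U^\ell\to\mathcal V^\ell$ and $\varepsilon_n\in[0,1]$ satisfy the common-reconstruction constraint $$\frac{\ell}{n}\sum_{i=0}^{n/\ell-1}\Pr\{V_{i\ell+1}^{i\ell+\ell}\ne q(u_{i\ell+1}^{i\ell+\ell})\}\le\varepsilon_n,$$ then $$\frac1n\sum_{t=1}^n\mathbf E\,\rho(u_t,V_t)\ \ge\ \tilde D_{U^\ell}\Big(C+\frac{2\log s+d\log M}{\ell}+\delta_2(\ell,n)+2\Delta(\varepsilon_n)\Big)-\rho_{\max}\,\varepsilon_n .$$ -/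

import Mathlib

open Filter MeasureTheory

/-- A discrete memoryless channel with finite output alphabet: the matrix of single-letter
transition probabilities `P(y|x)`. -/
structure DMC (𝒳 𝒴 : Type*) [Fintype 𝒴] where
  prob : 𝒳 → 𝒴 → ℝ
  nonneg : ∀ x y, 0 ≤ prob x y
  sum_eq_one : ∀ x, ∑ y, prob x y = 1

/-- Shannon entropy, in bits, of a probability mass function on a finite type. -/
noncomputable def entropyBits {α : Type*} [Fintype α] (p : α → ℝ) : ℝ :=
  ∑ a, Real.negMulLog (p a) / Real.log 2

/-- Binary entropy function `h₂`, in bits. -/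
noncomputable def h2 (p : ℝ) : ℝ := Real.binEntropy p / Real.log 2

/-- The mutual information `I(X;Y) = H(Y) - H(Y|X)`, in bits, between the input of a channel, with
probability mass function `p`, and its output. -/
noncomputable def DMC.mutualInfo {𝒳 𝒴 : Type*} [Fintype 𝒳] [Fintype 𝒴] (W : DMC 𝒳 𝒴)
    (p : 𝒳 → ℝ) : ℝ :=
  entropyBits (fun y => ∑ x, p x * W.prob x y) - ∑ x, p x * entropyBits (W.prob x)

/-- The channel capacity, in bits per channel use. -/
noncomputable def DMC.capacity {𝒳 𝒴 : Type*} [Fintype 𝒳] [Fintype 𝒴] (W : DMC 𝒳 𝒴) : ℝ :=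
  sSup (W.mutualInfo '' stdSimplex ℝ 𝒳)

/-- The random sequence `Y` is the response of the memoryless channel `W` to the deterministic
input sequence `x`. -/
structure DMC.IsOutput {Ω 𝒳 𝒴 : Type*} [MeasurableSpace Ω] [Fintype 𝒴] (W : DMC 𝒳 𝒴)
    (μ : Measure Ω) (x : ℕ → 𝒳) (Y : ℕ → Ω → 𝒴) : Prop where
  measurable : ∀ t y, MeasurableSet {ω | Y t ω = y}
  law : ∀ (m : ℕ) (y : ℕ → 𝒴),
    μ.real {ω | ∀ t < m, Y t ω = y t} = ∏ t ∈ Finset.range m, W.prob (x t) (y t)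

/-- A finite-state decoder equipped with a modulo-`ℓ` counter: initial state, next-state functions
`g_τ` and output functions `f_τ`, with `τ` the value of the counter. -/
structure FSDecoder (𝒴 𝒱 𝒵 : Type*) (ℓ : ℕ) where
  init : 𝒵
  next : Fin ℓ → 𝒵 → 𝒴 → 𝒵
  out : Fin ℓ → 𝒵 → 𝒴 → 𝒱

/-- The decoder state at time `t = 0, 1, 2, …` when the channel output is `y`;
`Fin.ofNat ℓ t` is `t mod ℓ`. -/
def FSDecoder.state {𝒴 𝒱 𝒵 : Type*} {ℓ : ℕ} [NeZero ℓ] (dec : FSDecoder 𝒴 𝒱 𝒵 ℓ)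
    (y : ℕ → 𝒴) : ℕ → 𝒵
  | 0 => dec.init
  | t + 1 => dec.next (Fin.ofNat ℓ t) (dec.state y t) (y t)

/-- `V` is a reconstruction of length `n`, with delay `d`, that the decoder produces from `Y`: the
symbol `V_t` is emitted at time `t + d`. The last `d` symbols (times `n - d ≤ t < n`), not yet
emitted when the transmission ends, are arbitrary, possibly random. -/
structure FSDecoder.IsReconstruction {Ω 𝒴 𝒱 𝒵 : Type*} [MeasurableSpace Ω] {ℓ : ℕ} [NeZero ℓ]
    (dec : FSDecoder 𝒴 𝒱 𝒵 ℓ) (d n : ℕ) (Y : ℕ → Ω → 𝒴) (V : ℕ → Ω → 𝒱) : Prop where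
  measurable : ∀ t < n, ∀ v, MeasurableSet {ω | V t ω = v}
  eq_out : ∀ t, t + d < n → ∀ ω,
    V t ω = dec.out (Fin.ofNat ℓ (t + d)) (dec.state (fun k => Y k ω) (t + d)) (Y (t + d) ω)

/-- The `i`-th (`i = 0, 1, …`) non-overlapping block of length `ℓ` of a sequence. -/
def block {α : Type*} (ℓ : ℕ) (a : ℕ → α) (i : ℕ) : Fin ℓ → α := fun j => a (i * ℓ + j)

open Classical in
/-- The empirical distribution of the random vector `U^ℓ`: the relative frequencies of the
`n / ℓ` non-overlapping `ℓ`-blocks of `u^n`. -/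
noncomputable def empDist {𝒰 : Type*} (ℓ n : ℕ) (u : ℕ → 𝒰) (b : Fin ℓ → 𝒰) : ℝ :=
  (ℓ : ℝ) / n * ((Finset.range (n / ℓ)).filter (fun i => block ℓ u i = b)).card

open Classical in
/-- The distribution of `q(A)` when `A` has distribution `p`. -/
noncomputable def mapDist {α β : Type*} [Fintype α] (q : α → β) (p : α → ℝ) (b : β) : ℝ :=
  ∑ a, if q a = b then p a else 0

/-- The empirical distortion per symbol `(1/ℓ) Ê ρ(U^ℓ, q(U^ℓ))` of a deterministic block map. -/
noncomputable def empDistortion {𝒰 𝒱 : Type*} [Fintype 𝒰] (ρ : 𝒰 → 𝒱 → ℝ) (ℓ n : ℕ) (u : ℕ → 𝒰)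
    (q : (Fin ℓ → 𝒰) → (Fin ℓ → 𝒱)) : ℝ :=
  1 / (ℓ : ℝ) * ∑ b, empDist ℓ n u b * ∑ j, ρ (b j) (q b j)

/-- The deterministic distortion-rate function `D̃_{U^ℓ}(R)`: the least empirical distortion of
block maps `q` with empirical output entropy at most `ℓ R`. The minimum is over a finite set, which
is non-empty for `R ≥ 0` because it contains the constant maps. -/
noncomputable def Dtilde {𝒰 𝒱 : Type*} [Fintype 𝒰] [Fintype 𝒱] (ρ : 𝒰 → 𝒱 → ℝ) (ℓ n : ℕ)
    (u : ℕ → 𝒰) (R : ℝ) : ℝ :=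
  sInf (empDistortion ρ ℓ n u ''
    {q : (Fin ℓ → 𝒰) → (Fin ℓ → 𝒱) | entropyBits (mapDist q (empDist ℓ n u)) ≤ ℓ * R})

/-- The redundancy term `δ₁(ℓ, n)` for alphabet sizes `J, K, L`; `r` is the `o(1/√n)` term. -/
noncomputable def delta1 (J K L ℓ n : ℕ) (r : ℕ → ℝ) : ℝ :=
  ((J : ℝ) * K) ^ ℓ * Real.logb 2 L / √(n : ℝ)
    + ((J : ℝ) * K * L) ^ ℓ * Real.logb 2 (Real.exp 1) / (2 * n) + r n

/-- The redundancy term `δ₂(ℓ, n)`; `η` is its positive sequence tending to zero. -/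
noncomputable def delta2 (J K L ℓ n : ℕ) (r η : ℕ → ℝ) : ℝ :=
  delta1 J K L ℓ n r
    + 2 * ℓ * (1 + Real.logb 2 J) ^ 2 / ((1 - η n) * Real.logb 2 n)
    + 2 * ℓ * (J : ℝ) ^ (2 * ℓ) * Real.logb 2 J / n + 1 / ℓ

/-- `Δ(ε) = h₂(ε) + ε ℓ log J`. -/
noncomputable def bigDelta (J ℓ : ℕ) (ε : ℝ) : ℝ := h2 ε + ε * ℓ * Real.logb 2 J

/-- The largest value of the distortion measure. -/
noncomputable def rhoMax {𝒰 𝒱 : Type*} (ρ : 𝒰 → 𝒱 → ℝ) : ℝ := ⨆ p : 𝒰 × 𝒱, ρ p.1 p.2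

/-! ### Push-forward of weights -/

section MapDist

variable {α β γ : Type*} [Fintype α]

/-! The point is that `q` itself is admissible in the minimum defining `Dtilde` at the stated rate.
Draw a block index `i` uniformly from the `N = n / ℓ` blocks. The source and the channel inputs are
deterministic, so `i` is the message, and the empirical law of `q(U^ℓ)` is the law of `a i = q(block
i)`. Its entropy is bounded by a one-shot converse (`entropy_mapDist_le`), a single application of
Gibbs' inequality to triples (index, output block, reconstruction block).

Three facts feed the converse. The output block fixes the reconstruction block up to `s M^d`
possibilities, namely the state at the start of the block and the last `d` symbols
(`exists_block_mem`); this costs `log s + d log M`. The divergence of the output block from the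
`ℓ`-fold product of the time-averaged output law splits over letters and averages to at most `ℓ C`
(`sum_prod_mul_log_sub_log`, `sum_mul_log_sub_log_le_capacity`). The error event costs a Fano term
over at most `J^ℓ` values, which is `Δ(ε)`.

Only the joint law of the output and reconstruction within one block enters, so the dependence
between blocks through the decoder state is harmless. All further terms of the rate are nonnegative
slack. Finally, replacing `V` by `q` changes the distortion only on the error event, by at most
`ρ_max` per symbol (`empDistortion_sub_le`). -/

theorem mapDist_nonneg {f : α → β} {p : α → ℝ} (hp : ∀ a, 0 ≤ p a) (b : β) :
    0 ≤ mapDist f p b :=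
  Finset.sum_nonneg fun a _ => by split_ifs <;> simp [hp a]

theorem sum_mapDist_mul [Fintype β] (f : α → β) (p : α → ℝ) (F : β → ℝ) :
    ∑ b, mapDist f p b * F b = ∑ a, p a * F (f a) := by
  classical
  simp only [mapDist, Finset.sum_mul]
  rw [Finset.sum_comm]
  refine Finset.sum_congr rfl fun a _ => ?_
  simp [ite_mul]

theorem sum_mapDist [Fintype β] (f : α → β) (p : α → ℝ) : ∑ b, mapDist f p b = ∑ a, p a := by
  simpa using sum_mapDist_mul f p fun _ => 1

theorem mapDist_mapDist [Fintype β] (g : β → γ) (f : α → β) (p : α → ℝ) :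
    mapDist g (mapDist f p) = mapDist (g ∘ f) p := by
  classical
  funext c
  have := sum_mapDist_mul f p fun b => if g b = c then (1 : ℝ) else 0
  simp only [mul_ite, mul_one, mul_zero] at this
  simpa [mapDist] using this

theorem le_mapDist {f : α → β} {p : α → ℝ} (hp : ∀ a, 0 ≤ p a) (a : α) :
    p a ≤ mapDist f p (f a) := by
  classical
  have h := Finset.single_le_sum (s := Finset.univ) (f := fun a' => if f a' = f a then p a' else 0)
    (fun a' _ => by split_ifs <;> simp [hp a']) (Finset.mem_univ a)
  simpa [mapDist] using h

/-- This keeps the Fano alphabet at the size of the source blocks, whatever the reproduction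
alphabet. -/
theorem card_support_mapDist_le [Fintype β] [DecidableEq β] (f : α → β) (p : α → ℝ) :
    (Finset.univ.filter fun b => mapDist f p b ≠ 0).card ≤ Fintype.card α := by
  classical
  refine (Finset.card_le_card (t := Finset.univ.image f) fun b hb => ?_).trans
    Finset.card_image_le
  by_contra hne
  refine (Finset.mem_filter.mp hb).2 (Finset.sum_eq_zero fun a _ => if_neg fun h => hne ?_)
  exact Finset.mem_image.mpr ⟨a, Finset.mem_univ a, h⟩

end MapDist

/-! ### Gibbs' inequality and a converse bound -/

/-- Termwise from `log x ≤ x - 1`. The reference weight may have smaller total mass, so it need not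
be normalized. -/
theorem sum_mul_log_sub_log_nonneg {κ : Type*} [Fintype κ] {P Q : κ → ℝ} (hP : ∀ x, 0 ≤ P x)
    (hQ : ∀ x, 0 ≤ Q x) (hPQ : ∀ x, P x ≠ 0 → Q x ≠ 0) (hle : ∑ x, Q x ≤ ∑ x, P x) :
    0 ≤ ∑ x, P x * (Real.log (P x) - Real.log (Q x)) := by
  have h : ∀ x, P x - Q x ≤ P x * (Real.log (P x) - Real.log (Q x)) := by
    intro x
    rcases eq_or_ne (P x) 0 with h0 | h0
    · simp [h0, hQ x]
    · have hp := lt_of_le_of_ne (hP x) h0.symm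
      have hq := lt_of_le_of_ne (hQ x) (hPQ x h0).symm
      have h1 := Real.log_le_sub_one_of_pos (div_pos hq hp)
      rw [Real.log_div hq.ne' hp.ne'] at h1
      have h2 := mul_le_mul_of_nonneg_left h1 hp.le
      have h3 : P x * (Q x / P x - 1) = Q x - P x := by field_simp
      rw [h3] at h2
      linarith
  have := Finset.sum_le_sum fun x (_ : x ∈ Finset.univ) => h x
  rw [Finset.sum_sub_distrib] at this
  linarith

/-- The guess of a letter `c` from an observation `v` that puts weight `1 - ε` on `v` and spreads
the weight `ε` uniformly over `m` letters. -/
noncomputable def fanoGuess {γ : Type*} [DecidableEq γ] (ε m : ℝ) (c v : γ) : ℝ :=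
  (if v = c then 1 - ε else 0) + ε / m

theorem fanoGuess_nonneg {γ : Type*} [DecidableEq γ] {ε m : ℝ} (h0 : 0 ≤ ε) (h1 : ε ≤ 1)
    (hm : 0 ≤ m) (c v : γ) : 0 ≤ fanoGuess ε m c v := by
  unfold fanoGuess
  have := div_nonneg h0 hm
  split_ifs <;> linarith

/-- The left side is affine and nondecreasing in the true error probability `e`, so `e = ε` is the
worst case; there, dropping `ε / m` beside `1 - ε` leaves the Fano expression. -/
theorem neg_log_fanoGuess_le {ε m e : ℝ} (h0 : 0 ≤ ε) (h1 : ε ≤ 1) (hm : 1 ≤ m)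
    (he0 : 0 ≤ e) (he : e ≤ ε) :
    (1 - e) * -Real.log (1 - ε + ε / m) + e * -Real.log (ε / m)
      ≤ Real.binEntropy ε + ε * Real.log m := by
  have hm0 : 0 < m := by linarith
  rcases h0.eq_or_lt with rfl | hε
  · have : e = 0 := le_antisymm he he0
    simp [this]
  have hq : 0 < ε / m := by positivity
  have hmono : -Real.log (1 - ε + ε / m) ≤ -Real.log (ε / m) := by
    apply neg_le_neg
    exact Real.log_le_log hq (by linarith)
  have h2 : (1 - e) * -Real.log (1 - ε + ε / m) + e * -Real.log (ε / m)
      ≤ (1 - ε) * -Real.log (1 - ε + ε / m) + ε * -Real.log (ε / m) := by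
    nlinarith
  have h3 : (1 - ε) * -Real.log (1 - ε + ε / m) ≤ (1 - ε) * -Real.log (1 - ε) := by
    rcases h1.eq_or_lt with rfl | hlt
    · simp
    · apply mul_le_mul_of_nonneg_left _ (by linarith)
      apply neg_le_neg
      exact Real.log_le_log (by linarith) (by linarith)
  have h4 : Real.binEntropy ε = (1 - ε) * -Real.log (1 - ε) + ε * -Real.log ε := by
    rw [Real.binEntropy, Real.log_inv, Real.log_inv]; ring
  rw [h4]
  rw [Real.log_div hε.ne' hm0.ne'] at h2 ⊢
  linarith

/-- Converse for list-type decoding: an index `i`, of weight `π i`, produces a pair `(y, v)` with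
probability `P i y v`, where `v` belongs to a set of at most `k` elements determined by `y`. If `v`
reproduces `a i` up to error probability `ε`, then the entropy of `a` is bounded by `log k`, the
average divergence of the law of `y` from any fixed law `Q`, and a Fano term. -/
theorem entropy_mapDist_le {ι β γ : Type*} [Fintype ι] [Fintype β] [Fintype γ] [DecidableEq γ]
    {π : ι → ℝ} (hπ0 : ∀ i, 0 ≤ π i) (hπ1 : ∑ i, π i = 1) (a : ι → γ)
    {P : ι → β → γ → ℝ} (hP0 : ∀ i y v, 0 ≤ P i y v) (hP1 : ∀ i, ∑ y, ∑ v, P i y v = 1)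
    {S : β → Finset γ} {k : ℕ} (hk : ∀ y, (S y).card ≤ k) (hk0 : 0 < k)
    (hS : ∀ i y v, P i y v ≠ 0 → v ∈ S y)
    {Q : β → ℝ} (hQ0 : ∀ y, 0 ≤ Q y) (hQ1 : ∑ y, Q y = 1)
    (hac : ∀ i y v, π i ≠ 0 → P i y v ≠ 0 → Q y ≠ 0)
    {m : ℕ} (hm0 : 1 ≤ m) (hm : (Finset.univ.filter fun c => mapDist a π c ≠ 0).card ≤ m)
    {ε : ℝ} (hε0 : 0 ≤ ε) (hε1 : ε ≤ 1)
    (hε : ∑ i, π i * ∑ y, ∑ v, (if v = a i then 0 else P i y v) ≤ ε) :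
    ∑ c, Real.negMulLog (mapDist a π c) ≤ Real.log k
      + ∑ i, π i * ∑ y, (∑ v, P i y v) * (Real.log (∑ v, P i y v) - Real.log (Q y))
      + (Real.binEntropy ε + ε * Real.log m) := by
  classical
  set p := mapDist a π with hp
  set G : γ → γ → ℝ := fanoGuess ε m with hG
  have hk0' : (0 : ℝ) < k := by exact_mod_cast hk0
  have hm0' : (1 : ℝ) ≤ m := by exact_mod_cast hm0
  have hG0 : ∀ c v, 0 ≤ G c v := fanoGuess_nonneg hε0 hε1 (by linarith)
  have hp0 : ∀ c, 0 ≤ p c := mapDist_nonneg hπ0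
  -- the total error probability
  set e : ℝ := ∑ i, π i * ∑ y, ∑ v, (if v = a i then 0 else P i y v) with he
  have hite0 : ∀ i y v, 0 ≤ (if v = a i then 0 else P i y v) := by
    intro i y v; split_ifs <;> simp [hP0 i y v]
  have he0 : 0 ≤ e := Finset.sum_nonneg fun i _ => mul_nonneg (hπ0 i)
    (Finset.sum_nonneg fun y _ => Finset.sum_nonneg fun v _ => hite0 i y v)
  -- Gibbs' inequality on triples
  let PP : ι × β × γ → ℝ := fun x => π x.1 * P x.1 x.2.1 x.2.2
  -- The reference measure: `π / p(a)` is the law of the index given its label, `1 / k` is uniform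
  -- on the list, and `G` tests the label against `v`. The missing factor `p(a)` is what produces
  -- the entropy of `a`.
  let QQ : ι × β × γ → ℝ := fun x => π x.1 / p (a x.1) * (Q x.2.1 *
    ((if x.2.2 ∈ S x.2.1 then (k : ℝ)⁻¹ else 0) * G (a x.1) x.2.2))
  have hPP0 : ∀ x, 0 ≤ PP x := fun x => mul_nonneg (hπ0 _) (hP0 _ _ _)
  have hQQ0 : ∀ x, 0 ≤ QQ x := by
    intro x
    refine mul_nonneg (div_nonneg (hπ0 _) (hp0 _)) (mul_nonneg (hQ0 _) (mul_nonneg ?_ (hG0 _ _)))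
    split_ifs <;> positivity
  have hPPsum : ∑ x, PP x = 1 := by
    simp only [PP, Fintype.sum_prod_type, ← Finset.mul_sum, hP1, mul_one, hπ1]
  -- Grouping indices by label leaves the sum of `G c v` over labels of positive mass: at most `1 -
  -- ε` from `c = v`, plus at most `m` terms `ε / m`.
  have hGsum : ∀ v, ∑ i, π i / p (a i) * G (a i) v ≤ 1 := by
    intro v
    have h1 : ∑ i, π i / p (a i) * G (a i) v = ∑ c, p c * ((p c)⁻¹ * G c v) := by
      rw [hp, sum_mapDist_mul a π fun c => (mapDist a π c)⁻¹ * G c v]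
      exact Finset.sum_congr rfl fun i _ => by rw [div_eq_mul_inv, mul_assoc]
    have h2 : ∀ c, p c * ((p c)⁻¹ * G c v)
        ≤ (if v = c then 1 - ε else 0) + (if p c ≠ 0 then ε / m else 0) := by
      intro c
      by_cases hc : p c = 0
      · simp only [hc, zero_mul, ne_eq, not_true, if_false, add_zero]
        split_ifs <;> linarith
      · rw [← mul_assoc, mul_inv_cancel₀ hc, one_mul, if_pos hc]
        exact le_rfl
    rw [h1]
    refine (Finset.sum_le_sum fun c _ => h2 c).trans ?_
    rw [Finset.sum_add_distrib, Finset.sum_ite_eq, if_pos (Finset.mem_univ v),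
      ← Finset.sum_filter, Finset.sum_const, nsmul_eq_mul]
    have h3 : ((Finset.univ.filter fun c => p c ≠ 0).card : ℝ) * (ε / m) ≤ m * (ε / m) := by
      have : ((Finset.univ.filter fun c => p c ≠ 0).card : ℝ) ≤ m := by exact_mod_cast hm
      gcongr
    have h4 : (m : ℝ) * (ε / m) = ε := by field_simp
    linarith
  have hQQsum : ∑ x, QQ x ≤ 1 := by
    have h1 : ∑ x, QQ x = ∑ y, Q y * ∑ v, (if v ∈ S y then (k : ℝ)⁻¹ else 0)
        * ∑ i, π i / p (a i) * G (a i) v := by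
      simp only [QQ, Fintype.sum_prod_type]
      rw [Finset.sum_comm]
      refine Finset.sum_congr rfl fun y _ => ?_
      rw [Finset.sum_comm, Finset.mul_sum]
      refine Finset.sum_congr rfl fun v _ => ?_
      rw [Finset.mul_sum, Finset.mul_sum]
      exact Finset.sum_congr rfl fun i _ => by ring
    rw [h1, ← hQ1]
    refine Finset.sum_le_sum fun y _ => mul_le_of_le_one_right (hQ0 y) ?_
    calc ∑ v, (if v ∈ S y then (k : ℝ)⁻¹ else 0) * ∑ i, π i / p (a i) * G (a i) v
        ≤ ∑ v, (if v ∈ S y then (k : ℝ)⁻¹ else 0) := by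
          refine Finset.sum_le_sum fun v _ => mul_le_of_le_one_right ?_ (hGsum v)
          split_ifs <;> positivity
      _ = (S y).card * (k : ℝ)⁻¹ := by
          rw [Finset.sum_ite_mem, Finset.univ_inter, Finset.sum_const, nsmul_eq_mul]
      _ ≤ k * (k : ℝ)⁻¹ := by
          have : ((S y).card : ℝ) ≤ k := by exact_mod_cast hk y
          gcongr
      _ = 1 := mul_inv_cancel₀ hk0'.ne'
  -- `G` can vanish only if `ε = 0` and `v ≠ a i`; but then the total error is zero and such triples
  -- carry no mass.
  have hGne : ∀ i y v, π i * P i y v ≠ 0 → G (a i) v ≠ 0 := by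
    intro i y v hne hG0'
    simp only [hG, fanoGuess] at hG0'
    have hq : 0 ≤ ε / m := by positivity
    have hεz : ε = 0 := by
      have : ε / m = 0 := by
        split_ifs at hG0' <;> linarith
      rcases div_eq_zero_iff.mp this with h | h
      · exact h
      · linarith
    have hva : v ≠ a i := by
      intro h
      rw [if_pos h, hεz] at hG0'
      norm_num at hG0'
    have hez : e = 0 := le_antisymm (hεz ▸ hε) he0
    have h1 := (Finset.sum_eq_zero_iff_of_nonneg (fun i _ => mul_nonneg (hπ0 i)
      (Finset.sum_nonneg fun y _ => Finset.sum_nonneg fun v _ => hite0 i y v))).mp hez i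
      (Finset.mem_univ i)
    rcases mul_eq_zero.mp h1 with h2 | h2
    · exact hne (by rw [h2, zero_mul])
    · have h3 := (Finset.sum_eq_zero_iff_of_nonneg
        (fun y _ => Finset.sum_nonneg fun v _ => hite0 i y v)).mp h2 y (Finset.mem_univ y)
      have h4 := (Finset.sum_eq_zero_iff_of_nonneg (fun v _ => hite0 i y v)).mp h3 v
        (Finset.mem_univ v)
      rw [if_neg hva] at h4
      exact hne (by rw [h4, mul_zero])
  have hpne : ∀ i, π i ≠ 0 → p (a i) ≠ 0 := fun i hi =>
    ((lt_of_le_of_ne (hπ0 i) hi.symm).trans_le (le_mapDist hπ0 i)).ne'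
  have hPQ : ∀ x, PP x ≠ 0 → QQ x ≠ 0 := by
    rintro ⟨i, y, v⟩ hne
    have hi : π i ≠ 0 := left_ne_zero_of_mul hne
    have hPne : P i y v ≠ 0 := right_ne_zero_of_mul hne
    simp only [QQ, if_pos (hS i y v hPne)]
    exact mul_ne_zero (div_ne_zero hi (hpne i hi)) (mul_ne_zero (hac i y v hi hPne)
      (mul_ne_zero (inv_ne_zero hk0'.ne') (hGne i y v hne)))
  have hgibbs := sum_mul_log_sub_log_nonneg hPP0 hQQ0 hPQ (hQQsum.trans hPPsum.ge)
  -- expand the logarithms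
  set w : ι → β → ℝ := fun i y => ∑ v, P i y v with hw
  have hterm : ∀ i y v, PP (i, y, v) * (Real.log (PP (i, y, v)) - Real.log (QQ (i, y, v)))
      ≤ π i * P i y v * (Real.log (p (a i)))
        + π i * (P i y v * (Real.log (w i y) - Real.log (Q y)))
        + π i * P i y v * Real.log k
        + π i * (P i y v * -Real.log (G (a i) v)) := by
    intro i y v
    by_cases hne : π i * P i y v = 0
    · have h1 : PP (i, y, v) = 0 := hne
      rw [h1, zero_mul, ← mul_assoc, ← mul_assoc, hne]
      simp
    have hi : π i ≠ 0 := left_ne_zero_of_mul hne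
    have hPne : P i y v ≠ 0 := right_ne_zero_of_mul hne
    have hPpos : 0 < P i y v := lt_of_le_of_ne (hP0 _ _ _) hPne.symm
    have hPw : P i y v ≤ w i y :=
      Finset.single_le_sum (f := fun v => P i y v) (fun v _ => hP0 i y v) (Finset.mem_univ v)
    -- Bounding the joint probability by its `y`-marginal discards the randomness of `v` given `y`.
    have h1 : Real.log (PP (i, y, v)) ≤ Real.log (π i) + Real.log (w i y) := by
      simp only [PP]
      rw [Real.log_mul hi hPne]
      have := Real.log_le_log hPpos hPw
      linarith
    have h2 : Real.log (QQ (i, y, v)) = Real.log (π i) - Real.log (p (a i)) + (Real.log (Q y)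
        + (- Real.log k + Real.log (G (a i) v))) := by
      simp only [QQ, if_pos (hS i y v hPne)]
      have hk1 := inv_ne_zero hk0'.ne'
      have hq := hac i y v hi hPne
      have hg := hGne i y v hne
      rw [Real.log_mul (div_ne_zero hi (hpne i hi)) (mul_ne_zero hq (mul_ne_zero hk1 hg)),
        Real.log_div hi (hpne i hi), Real.log_mul hq (mul_ne_zero hk1 hg), Real.log_mul hk1 hg,
        Real.log_inv]
    have h3 := mul_le_mul_of_nonneg_left (sub_le_sub_right h1 (Real.log (QQ (i, y, v))))
      (hPP0 (i, y, v))
    refine h3.trans (le_of_eq ?_)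
    rw [h2]
    simp only [PP]
    ring
  have hsum := hgibbs.trans (Fintype.sum_prod_type _ |>.trans_le (Finset.sum_le_sum fun i _ =>
    (Fintype.sum_prod_type _).trans_le (Finset.sum_le_sum fun y _ => Finset.sum_le_sum fun v _ =>
      hterm i y v)))
  simp only [Finset.sum_add_distrib, ← Finset.mul_sum, ← Finset.sum_mul, hP1, mul_one, hπ1,
    one_mul] at hsum
  -- identify the three sums
  have hH : ∑ c, Real.negMulLog (p c) = -∑ i, π i * Real.log (p (a i)) := by
    rw [← sum_mapDist_mul a π fun c => Real.log (p c), ← Finset.sum_neg_distrib]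
    exact Finset.sum_congr rfl fun c _ => by rw [Real.negMulLog, ← hp]; ring
  have hF : ∑ i, π i * ∑ y, ∑ v, P i y v * -Real.log (G (a i) v)
      = (1 - e) * -Real.log (1 - ε + ε / m) + e * -Real.log (ε / m) := by
    have h1 : ∀ i y v, P i y v * -Real.log (G (a i) v)
        = P i y v * -Real.log (1 - ε + ε / m) + (if v = a i then 0 else P i y v)
          * (Real.log (1 - ε + ε / m) - Real.log (ε / m)) := by
      intro i y v
      simp only [hG, fanoGuess]
      split_ifs
      · ring
      · rw [zero_add]; ring
    simp only [h1, Finset.sum_add_distrib, ← Finset.sum_mul, hP1, one_mul, mul_add, ← mul_assoc,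
      hπ1]
    rw [← he]
    ring
  have hfano := neg_log_fanoGuess_le hε0 hε1 hm0' he0 hε
  rw [hF] at hsum
  rw [hH]
  linarith

/-! ### The channel -/

theorem Real.negMulLog_le_one {x : ℝ} (hx : 0 ≤ x) : Real.negMulLog x ≤ 1 := by
  rcases hx.eq_or_lt with rfl | hx
  · simp
  have h := Real.log_le_sub_one_of_pos (inv_pos.mpr hx)
  rw [Real.log_inv] at h
  have h2 := mul_le_mul_of_nonneg_left h hx.le
  have h3 : x * (x⁻¹ - 1) = 1 - x := by field_simp
  rw [Real.negMulLog]
  linarith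

theorem entropyBits_nonneg {α : Type*} [Fintype α] {p : α → ℝ} (h0 : ∀ a, 0 ≤ p a)
    (h1 : ∑ a, p a = 1) : 0 ≤ entropyBits p :=
  Finset.sum_nonneg fun a _ => div_nonneg (Real.negMulLog_nonneg (h0 a)
    (h1 ▸ Finset.single_le_sum (fun b _ => h0 b) (Finset.mem_univ a)))
    (Real.log_nonneg one_le_two)

namespace DMC

variable {𝒳 𝒴 : Type*} [Fintype 𝒳] [Fintype 𝒴] (W : DMC 𝒳 𝒴)

/-- Needed for the supremum defining the capacity to dominate its members; a crude bound of one nat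
per output letter suffices. -/
theorem bddAbove_mutualInfo : BddAbove (W.mutualInfo '' stdSimplex ℝ 𝒳) := by
  refine ⟨∑ _y : 𝒴, 1 / Real.log 2, ?_⟩
  rintro _ ⟨p, hp, rfl⟩
  have h1 : 0 ≤ ∑ x, p x * entropyBits (W.prob x) := Finset.sum_nonneg fun x _ =>
    mul_nonneg (hp.1 x) (entropyBits_nonneg (W.nonneg x) (W.sum_eq_one x))
  have h2 : entropyBits (fun y => ∑ x, p x * W.prob x y) ≤ ∑ _y : 𝒴, 1 / Real.log 2 :=
    Finset.sum_le_sum fun y _ => div_le_div_of_nonneg_right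
      (Real.negMulLog_le_one (Finset.sum_nonneg fun x _ => mul_nonneg (hp.1 x) (W.nonneg x y)))
      (Real.log_nonneg one_le_two)
  unfold mutualInfo
  linarith

/-- The average divergence of the output laws from the average output law is at most the
capacity. -/
theorem sum_mul_log_sub_log_le_capacity {κ : Type*} [Fintype κ] {π : κ → ℝ} (hπ0 : ∀ i, 0 ≤ π i)
    (hπ1 : ∑ i, π i = 1) (x : κ → 𝒳) :
    ∑ i, π i * ∑ y, W.prob (x i) y *
      (Real.log (W.prob (x i) y) - Real.log (∑ j, π j * W.prob (x j) y))
      ≤ W.capacity * Real.log 2 := by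
  have hlog : 0 < Real.log 2 := Real.log_pos one_lt_two
  have hmem : mapDist x π ∈ stdSimplex ℝ 𝒳 :=
    ⟨mapDist_nonneg hπ0, by rw [sum_mapDist, hπ1]⟩
  have hle : W.mutualInfo (mapDist x π) ≤ W.capacity :=
    le_csSup W.bddAbove_mutualInfo ⟨_, hmem, rfl⟩
  refine le_trans (le_of_eq ?_) (mul_le_mul_of_nonneg_right hle hlog.le)
  have hout : ∀ y, ∑ j, π j * W.prob (x j) y = ∑ a, mapDist x π a * W.prob a y := fun y =>
    (sum_mapDist_mul x π fun a => W.prob a y).symm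
  simp only [hout]
  rw [← sum_mapDist_mul x π fun a => ∑ y, W.prob a y * (Real.log (W.prob a y) -
    Real.log (∑ a', mapDist x π a' * W.prob a' y))]
  unfold mutualInfo entropyBits
  simp only [Real.negMulLog, ← Finset.sum_div, mul_sub, Finset.sum_sub_distrib, sub_mul,
    Finset.mul_sum, mul_div_assoc']
  rw [Finset.sum_div, Finset.sum_mul]
  rw [sub_eq_add_neg, add_comm, sub_eq_add_neg]
  congr 1
  · rw [Finset.sum_comm, ← Finset.sum_neg_distrib]
    refine Finset.sum_congr rfl fun y _ => ?_
    rw [div_mul_cancel₀ _ hlog.ne', neg_mul, Finset.sum_mul]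
    congr 1
    exact Finset.sum_congr rfl fun a _ => by ring
  · rw [div_mul_cancel₀ _ hlog.ne', ← Finset.sum_neg_distrib]
    refine Finset.sum_congr rfl fun a _ => ?_
    rw [← Finset.sum_neg_distrib]
    exact Finset.sum_congr rfl fun y _ => by ring

end DMC

theorem sum_prod_mul_sum {κ β : Type*} [Fintype κ] [DecidableEq κ] [Fintype β] (w : κ → β → ℝ)
    (hw : ∀ j, ∑ b, w j b = 1) (g : κ → β → ℝ) :
    ∑ y : κ → β, (∏ j, w j (y j)) * ∑ j, g j (y j) = ∑ j, ∑ b, w j b * g j b := by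
  simp only [Finset.mul_sum]
  rw [Finset.sum_comm]
  refine Finset.sum_congr rfl fun j _ => ?_
  -- Absorbing `g j` into the `j`-th factor turns the summand into a product over coordinates, so
  -- sum and product can be exchanged.
  have h1 : ∀ y : κ → β, (∏ k, w k (y k)) * g j (y j)
      = ∏ k, w k (y k) * (if k = j then g k (y k) else 1) := fun y => by
    rw [Finset.prod_mul_distrib, Finset.prod_ite_eq' Finset.univ j fun k => g k (y k),
      if_pos (Finset.mem_univ j)]
  simp only [h1]
  rw [← Fintype.prod_sum fun k b => w k b * (if k = j then g k b else 1),
    Finset.prod_eq_single j]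
  · simp
  · intro k _ hk
    simp [hk, hw]
  · simp

theorem sum_prod_eq_one {κ β : Type*} [Fintype κ] [DecidableEq κ] [Fintype β] (w : κ → β → ℝ)
    (hw : ∀ j, ∑ b, w j b = 1) : ∑ y : κ → β, ∏ j, w j (y j) = 1 := by
  rw [← Fintype.prod_sum w]
  simp [hw]

/-- Chain rule for the divergence of product laws. -/
theorem sum_prod_mul_log_sub_log {κ β : Type*} [Fintype κ] [DecidableEq κ] [Fintype β]
    (w : κ → β → ℝ) (hw : ∀ j, ∑ b, w j b = 1) (Q : β → ℝ)
    (hQ : ∀ j b, w j b ≠ 0 → Q b ≠ 0) :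
    ∑ y : κ → β, (∏ j, w j (y j)) * (Real.log (∏ j, w j (y j)) - Real.log (∏ j, Q (y j)))
      = ∑ j, ∑ b, w j b * (Real.log (w j b) - Real.log (Q b)) := by
  rw [← sum_prod_mul_sum w hw fun j b => Real.log (w j b) - Real.log (Q b)]
  refine Finset.sum_congr rfl fun y _ => ?_
  by_cases h : ∏ j, w j (y j) = 0
  · rw [h, zero_mul, zero_mul]
  · have hne : ∀ j, w j (y j) ≠ 0 := fun j => Finset.prod_ne_zero_iff.mp h j (Finset.mem_univ j)
    rw [Real.log_prod fun j _ => hne j, Real.log_prod fun j _ => hQ j _ (hne j),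
      Finset.sum_sub_distrib]

/-! ### Laws of blocks of channel outputs. -/

theorem sum_measureReal_inter_fiber {Ω γ : Type*} [MeasurableSpace Ω] [Fintype γ] (μ : Measure Ω)
    [IsFiniteMeasure μ] {f : Ω → γ} (hf : ∀ c, MeasurableSet {ω | f ω = c}) (A : Set Ω) :
    ∑ c, μ.real ({ω | f ω = c} ∩ A) = μ.real A := by
  have h := sum_measureReal_preimage_singleton (μ := μ.restrict A) (f := f) Finset.univ
    fun c _ => hf c
  simp only [Finset.coe_univ, Set.preimage_univ, measureReal_restrict_apply_univ] at h
  rw [← h]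
  exact Finset.sum_congr rfl fun c _ => (measureReal_restrict_apply (hf c)).symm

/-- The channel law is given for initial segments only; the leading coordinates are summed out one
at a time, each contributing a factor `1`. -/
theorem DMC.IsOutput.law_Ico {Ω 𝒳 𝒴 : Type*} [MeasurableSpace Ω] [Fintype 𝒴] {W : DMC 𝒳 𝒴}
    {μ : Measure Ω} [IsFiniteMeasure μ] {x : ℕ → 𝒳} {Y : ℕ → Ω → 𝒴} (hY : W.IsOutput μ x Y)
    (m k : ℕ) (hmk : m ≤ k) (y : ℕ → 𝒴) :
    μ.real {ω | ∀ t, m ≤ t → t < k → Y t ω = y t} = ∏ t ∈ Finset.Ico m k, W.prob (x t) (y t) := by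
  classical
  induction m generalizing y with
  | zero => simpa using hY.law k y
  | succ m ih =>
    have h := fun b => ih (Nat.le_of_succ_le hmk) (Function.update y m b)
    rw [← sum_measureReal_inter_fiber μ (hY.measurable m)]
    have h1 : ∀ b, μ.real ({ω | Y m ω = b} ∩ {ω | ∀ t, m + 1 ≤ t → t < k → Y t ω = y t})
        = W.prob (x m) b * ∏ t ∈ Finset.Ico (m + 1) k, W.prob (x t) (y t) := by
      intro b
      have h2 := h b
      rw [Finset.prod_eq_prod_Ico_succ_bot hmk, Function.update_self] at h2
      have h3 : ∏ t ∈ Finset.Ico (m + 1) k, W.prob (x t) (Function.update y m b t)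
          = ∏ t ∈ Finset.Ico (m + 1) k, W.prob (x t) (y t) := by
        refine Finset.prod_congr rfl fun t ht => ?_
        have : t ≠ m := by have := (Finset.mem_Ico.mp ht).1; omega
        rw [Function.update_of_ne this]
      rw [h3] at h2
      rw [← h2]
      congr 1
      ext ω
      simp only [Set.mem_inter_iff, Set.mem_ofPred_eq]
      constructor
      · rintro ⟨hb, ht⟩ t hmt htk
        rcases eq_or_ne t m with rfl | hne
        · rw [Function.update_self, hb]
        · rw [Function.update_of_ne hne]
          exact ht t (by omega) htk
      · intro ht
        refine ⟨by simpa using ht m le_rfl hmk, fun t hmt htk => ?_⟩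
        have := ht t (by omega) htk
        rwa [Function.update_of_ne (by omega)] at this
    rw [Finset.sum_congr rfl fun b _ => h1 b, ← Finset.sum_mul, W.sum_eq_one, one_mul]

theorem block_eq_iff {α : Type*} {ℓ : ℕ} (a : ℕ → α) (i : ℕ) (b : Fin ℓ → α) :
    block ℓ a i = b ↔ ∀ j : Fin ℓ, a (i * ℓ + j) = b j := funext_iff

theorem DMC.IsOutput.law_block {Ω 𝒳 𝒴 : Type*} [MeasurableSpace Ω] [Fintype 𝒴] {W : DMC 𝒳 𝒴}
    {μ : Measure Ω} [IsFiniteMeasure μ] {x : ℕ → 𝒳} {Y : ℕ → Ω → 𝒴} (hY : W.IsOutput μ x Y)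
    {ℓ : ℕ} [NeZero ℓ] (i : ℕ) (y : Fin ℓ → 𝒴) :
    μ.real {ω | block ℓ (fun t => Y t ω) i = y} = ∏ j : Fin ℓ, W.prob (x (i * ℓ + j)) (y j) := by
  have h := hY.law_Ico (i * ℓ) (i * ℓ + ℓ) (Nat.le_add_right _ _)
    fun t => y (Fin.ofNat ℓ (t - i * ℓ))
  rw [Finset.prod_Ico_eq_prod_range, Nat.add_sub_cancel_left, Finset.prod_range] at h
  have hsub : ∀ j : Fin ℓ, Fin.ofNat ℓ (i * ℓ + j - i * ℓ) = j := fun j => by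
    rw [Nat.add_sub_cancel_left]; exact Fin.ofNat_val_eq_self j
  simp only [hsub] at h
  rw [← h]
  congr 1
  ext ω
  simp only [Set.mem_ofPred_eq, block_eq_iff]
  constructor
  · intro hj t h1 h2
    have := hj ⟨t - i * ℓ, by omega⟩
    simp only [Nat.add_sub_cancel' h1] at this
    rw [this]
    congr 1
    exact Fin.ext (by simp [Fin.ofNat, Nat.mod_eq_of_lt (show t - i * ℓ < ℓ by omega)])
  · intro ht j
    have := ht (i * ℓ + j) (by omega) (by omega)
    rwa [hsub j] at this

theorem measurableSet_block {Ω α : Type*} [MeasurableSpace Ω] {ℓ : ℕ} {V : ℕ → Ω → α} {i : ℕ}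
    (hV : ∀ j : Fin ℓ, ∀ v, MeasurableSet {ω | V (i * ℓ + j) ω = v}) (b : Fin ℓ → α) :
    MeasurableSet {ω | block ℓ (fun t => V t ω) i = b} := by
  simp only [block_eq_iff, Set.ofPred_forall]
  exact MeasurableSet.iInter fun j => hV j (b j)

/-! ### The decoder -/

/-- The decoder state `t` steps after the beginning of a block with channel outputs `y`, if the block
starts in state `z`. -/
def FSDecoder.stateFrom {𝒴 𝒱 𝒵 : Type*} {ℓ : ℕ} [NeZero ℓ] (dec : FSDecoder 𝒴 𝒱 𝒵 ℓ)
    (y : Fin ℓ → 𝒴) (z : 𝒵) : ℕ → 𝒵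
  | 0 => z
  | t + 1 => dec.next (Fin.ofNat ℓ t) (dec.stateFrom y z t) (y (Fin.ofNat ℓ t))

theorem Fin.ofNat_mul_add {ℓ : ℕ} [NeZero ℓ] (i t : ℕ) :
    Fin.ofNat ℓ (i * ℓ + t) = Fin.ofNat ℓ t :=
  Fin.ext (by simp [Fin.ofNat, Nat.add_mod])

theorem FSDecoder.state_eq_stateFrom {𝒴 𝒱 𝒵 : Type*} {ℓ : ℕ} [NeZero ℓ]
    (dec : FSDecoder 𝒴 𝒱 𝒵 ℓ) (y : ℕ → 𝒴) (i : ℕ) (t : ℕ) (ht : t ≤ ℓ) :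
    dec.state y (i * ℓ + t) = dec.stateFrom (block ℓ y i) (dec.state y (i * ℓ)) t := by
  induction t with
  | zero => rfl
  | succ t ih =>
    have hval : ((Fin.ofNat ℓ t : Fin ℓ) : ℕ) = t := Nat.mod_eq_of_lt ht
    rw [← add_assoc, FSDecoder.state, ih (by omega), Fin.ofNat_mul_add, FSDecoder.stateFrom]
    simp only [block, hval]

open Classical in
/-- Given a block of channel outputs, the corresponding block of reconstruction symbols is one of
at most `|𝒵| |𝒱|^d`. -/
theorem FSDecoder.IsReconstruction.exists_block_mem {Ω 𝒴 𝒱 𝒵 : Type*} [MeasurableSpace Ω]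
    [Fintype 𝒱] [Fintype 𝒵] [Nonempty 𝒱] {ℓ : ℕ} [NeZero ℓ] {dec : FSDecoder 𝒴 𝒱 𝒵 ℓ} {d n : ℕ}
    {Y : ℕ → Ω → 𝒴} {V : ℕ → Ω → 𝒱} (hV : dec.IsReconstruction d n Y V) (hdvd : ℓ ∣ n) :
    ∃ S : (Fin ℓ → 𝒴) → Finset (Fin ℓ → 𝒱),
      (∀ y, (S y).card ≤ Fintype.card 𝒵 * Fintype.card 𝒱 ^ d) ∧
      ∀ i < n / ℓ, ∀ ω, block ℓ (fun t => V t ω) i ∈ S (block ℓ (fun t => Y t ω) i) := by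
  have : Nonempty 𝒵 := ⟨dec.init⟩
  have hcard : 0 < Fintype.card 𝒵 := Fintype.card_pos
  rcases le_or_gt ℓ d with hd | hd
  · refine ⟨fun _ => Finset.univ, fun _ => ?_, fun _ _ _ => Finset.mem_univ _⟩
    rw [Finset.card_univ, Fintype.card_fun, Fintype.card_fin]
    calc Fintype.card 𝒱 ^ ℓ ≤ Fintype.card 𝒱 ^ d := Nat.pow_le_pow_right Fintype.card_pos hd
      _ ≤ _ := Nat.le_mul_of_pos_left _ hcard
  -- Symbols with `j + d < ℓ` are emitted within the same block and follow from its initial state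
  -- and outputs. The other `d` are simply listed, so it is irrelevant whether they are emitted in a
  -- later block or never.
  · let dcd : (Fin ℓ → 𝒴) → 𝒵 × (Fin d → 𝒱) → (Fin ℓ → 𝒱) := fun y zw j =>
      if h : (j : ℕ) + d < ℓ then
        dec.out (Fin.ofNat ℓ (j + d)) (dec.stateFrom y zw.1 (j + d)) (y ⟨j + d, h⟩)
      else zw.2 ⟨j + d - ℓ, by omega⟩
    refine ⟨fun y => Finset.univ.image (dcd y), fun y => ?_, fun i hi ω => ?_⟩
    · refine Finset.card_image_le.trans ?_
      simp
    · refine Finset.mem_image.mpr ⟨(dec.state (fun t => Y t ω) (i * ℓ),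
        fun k => V (i * ℓ + (k + ℓ - d)) ω), Finset.mem_univ _, ?_⟩
      funext j
      have hil : i * ℓ + ℓ ≤ n := by
        obtain ⟨N, rfl⟩ := hdvd
        rw [Nat.mul_div_cancel_left _ (NeZero.pos ℓ)] at hi
        nlinarith
      simp only [dcd, block]
      split_ifs with h
      · rw [hV.eq_out (i * ℓ + j) (by omega) ω, add_assoc, Fin.ofNat_mul_add,
          dec.state_eq_stateFrom _ _ _ h.le]
      · have : (j : ℕ) + d - ℓ + ℓ - d = j := by omega
        rw [this]

/-! ### The block map -/

/-- Turns relative frequencies into a uniformly random block index, the message of the converse. -/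
theorem empDist_eq_mapDist {𝒰 : Type*} {ℓ N : ℕ} (hℓ : 0 < ℓ) (u : ℕ → 𝒰) :
    empDist ℓ (N * ℓ) u = mapDist (fun i : Fin N => block ℓ u i) (fun _ => 1 / (N : ℝ)) := by
  classical
  funext b
  have hℓ' : (ℓ : ℝ) ≠ 0 := by exact_mod_cast hℓ.ne'
  have h : mapDist (fun i : Fin N => block ℓ u i) (fun _ => 1 / (N : ℝ)) b
      = ∑ i ∈ Finset.range N, if block ℓ u i = b then 1 / (N : ℝ) else 0 := by
    rw [mapDist, ← Fin.sum_univ_eq_sum_range fun i => if block ℓ u i = b then 1 / (N : ℝ) else 0]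
    exact Finset.sum_congr rfl fun i _ => by congr
  rw [h, empDist, Nat.mul_div_cancel _ hℓ, ← Finset.sum_filter, Finset.sum_const, nsmul_eq_mul]
  push_cast
  rw [mul_comm (N : ℝ), div_mul_eq_div_div, div_self hℓ', mul_comm]

theorem entropyBits_mul_log_two {α : Type*} [Fintype α] (p : α → ℝ) :
    entropyBits p * Real.log 2 = ∑ a, Real.negMulLog (p a) := by
  rw [entropyBits, ← Finset.sum_div, div_mul_cancel₀ _ (Real.log_pos one_lt_two).ne']

/-- The entropy of the common reconstruction is at most the information that the decoder gets from
the channel, from its memory and from its delay, up to a Fano term. -/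
theorem entropyBits_mapDist_block_le {𝒰 𝒳 𝒴 𝒱 𝒵 Ω : Type*} [Fintype 𝒰] [Fintype 𝒳] [Fintype 𝒴]
    [Fintype 𝒱] [Fintype 𝒵] [MeasurableSpace Ω] {ℓ : ℕ} [NeZero ℓ] (μ : Measure Ω)
    [IsProbabilityMeasure μ] {W : DMC 𝒳 𝒴} (u : ℕ → 𝒰) {x : ℕ → 𝒳} {Y : ℕ → Ω → 𝒴}
    (hY : W.IsOutput μ x Y) {dec : FSDecoder 𝒴 𝒱 𝒵 ℓ} {d N : ℕ} (hN : 0 < N) {V : ℕ → Ω → 𝒱}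
    (hV : dec.IsReconstruction d (N * ℓ) Y V) (q : (Fin ℓ → 𝒰) → (Fin ℓ → 𝒱)) {ε : ℝ}
    (hε0 : 0 ≤ ε) (hε1 : ε ≤ 1)
    (hε : 1 / (N : ℝ) * ∑ i ∈ Finset.range N,
      μ.real {ω | block ℓ (fun t => V t ω) i ≠ q (block ℓ u i)} ≤ ε) :
    entropyBits (mapDist q (empDist ℓ (N * ℓ) u)) ≤ ℓ * W.capacity
      + Real.logb 2 (Fintype.card 𝒵) + d * Real.logb 2 (Fintype.card 𝒱)
      + bigDelta (Fintype.card 𝒰) ℓ ε := by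
  classical
  have hℓ : 0 < ℓ := NeZero.pos ℓ
  have hℓ' : (ℓ : ℝ) ≠ 0 := by exact_mod_cast hℓ.ne'
  have hN' : (N : ℝ) ≠ 0 := by exact_mod_cast hN.ne'
  have hlog : 0 < Real.log 2 := Real.log_pos one_lt_two
  obtain ⟨ω₀⟩ : Nonempty Ω := nonempty_of_isProbabilityMeasure μ
  have : Nonempty 𝒱 := ⟨V 0 ω₀⟩
  have : Nonempty 𝒰 := ⟨u 0⟩
  have : Nonempty 𝒵 := ⟨dec.init⟩
  have hs : 0 < Fintype.card 𝒵 := Fintype.card_pos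
  have hM : 0 < Fintype.card 𝒱 := Fintype.card_pos
  have hJ : 0 < Fintype.card 𝒰 := Fintype.card_pos
  obtain ⟨S, hScard, hSmem⟩ := hV.exists_block_mem (Dvd.intro_left N rfl)
  rw [Nat.mul_div_cancel _ hℓ] at hSmem
  let a : Fin N → Fin ℓ → 𝒱 := fun i => q (block ℓ u i)
  let VB : Fin N → Ω → Fin ℓ → 𝒱 := fun i ω => block ℓ (fun t => V t ω) i
  let YB : Fin N → Ω → Fin ℓ → 𝒴 := fun i ω => block ℓ (fun t => Y t ω) i
  have hlt : ∀ (i : Fin N) (j : Fin ℓ), (i : ℕ) * ℓ + j < N * ℓ := fun i j => by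
    have := i.2; have := j.2; nlinarith
  have hVB : ∀ i v, MeasurableSet {ω | VB i ω = v} := fun i v =>
    measurableSet_block (fun j => hV.measurable _ (hlt i j)) v
  have hYB : ∀ i y, MeasurableSet {ω | YB i ω = y} := fun i y =>
    measurableSet_block (fun j => hY.measurable _) y
  have hYlaw : ∀ i y, μ.real {ω | YB i ω = y} = ∏ j : Fin ℓ, W.prob (x (i * ℓ + j)) (y j) :=
    fun i y => hY.law_block i y
  let P : Fin N → (Fin ℓ → 𝒴) → (Fin ℓ → 𝒱) → ℝ := fun i y v =>
    μ.real ({ω | VB i ω = v} ∩ {ω | YB i ω = y})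
  have hPsum : ∀ i y, ∑ v, P i y v = ∏ j : Fin ℓ, W.prob (x (i * ℓ + j)) (y j) := fun i y =>
    (sum_measureReal_inter_fiber μ (hVB i) _).trans (hYlaw i y)
  -- The output law averaged over all `N * ℓ` times, not per position in the block: a single input
  -- distribution then bounds the whole divergence by capacity.
  let p : 𝒴 → ℝ := fun b => ∑ k : Fin N × Fin ℓ, 1 / ((N : ℝ) * ℓ) * W.prob (x (k.1 * ℓ + k.2)) b
  have hp0 : ∀ b, 0 ≤ p b := fun b =>
    Finset.sum_nonneg fun k _ => mul_nonneg (by positivity) (W.nonneg _ _)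
  have hκ1 : ∑ _k : Fin N × Fin ℓ, 1 / ((N : ℝ) * ℓ) = 1 := by
    rw [Finset.sum_const, Finset.card_univ, Fintype.card_prod, Fintype.card_fin, Fintype.card_fin,
      nsmul_eq_mul]
    push_cast
    field_simp
  have hp1 : ∑ b, p b = 1 := by
    simp only [p]
    rw [Finset.sum_comm]
    refine (Finset.sum_congr rfl fun k _ => ?_).trans hκ1
    rw [← Finset.mul_sum, W.sum_eq_one, mul_one]
  have hac : ∀ (i : Fin N) (j : Fin ℓ) b, W.prob (x (i * ℓ + j)) b ≠ 0 → p b ≠ 0 := by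
    intro i j b hne h0
    have := (Finset.sum_eq_zero_iff_of_nonneg (fun k _ => mul_nonneg (by positivity)
      (W.nonneg _ _))).mp h0 (i, j) (Finset.mem_univ _)
    rcases mul_eq_zero.mp this with h | h
    · exact absurd h (by positivity)
    · exact hne h
  have hsupp : (Finset.univ.filter fun c => mapDist a (fun _ => 1 / (N : ℝ)) c ≠ 0).card
      ≤ Fintype.card 𝒰 ^ ℓ := by
    have h1 : mapDist a (fun _ => 1 / (N : ℝ)) = mapDist q (empDist ℓ (N * ℓ) u) := by
      rw [empDist_eq_mapDist hℓ, mapDist_mapDist]; rfl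
    rw [h1]
    refine (card_support_mapDist_le q _).trans ?_
    simp
  have herr : ∑ i : Fin N, 1 / (N : ℝ) * ∑ y, ∑ v, (if v = a i then 0 else P i y v) ≤ ε := by
    rw [← Finset.mul_sum]
    refine le_trans (le_of_eq ?_) hε
    congr 1
    rw [← Fin.sum_univ_eq_sum_range
      fun i => μ.real {ω | block ℓ (fun t => V t ω) i ≠ q (block ℓ u i)}]
    refine Finset.sum_congr rfl fun i _ => ?_
    have h1 : ∀ v y, (if v = a i then 0 else P i y v)
        = μ.real ({ω | YB i ω = y} ∩ ({ω | VB i ω = v} ∩ {ω | VB i ω ≠ a i})) := by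
      intro v y
      split_ifs with h
      · have : ({ω | VB i ω = v} ∩ {ω | VB i ω ≠ a i}) = ∅ := by
          ext ω; simp [h]
        rw [this, Set.inter_empty, measureReal_empty]
      · have : ({ω | VB i ω = v} ∩ {ω | VB i ω ≠ a i}) = {ω | VB i ω = v} := by
          ext ω
          simp only [Set.mem_inter_iff, Set.mem_ofPred_eq, and_iff_left_iff_imp]
          rintro rfl
          exact h
        rw [this, Set.inter_comm]
    rw [Finset.sum_comm]
    simp only [h1]
    rw [Finset.sum_congr rfl fun v _ => sum_measureReal_inter_fiber μ (hYB i) _]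
    exact sum_measureReal_inter_fiber μ (hVB i) _
  have hmain := entropy_mapDist_le (π := fun _ : Fin N => 1 / (N : ℝ)) (fun _ => by positivity)
    (by simp [hN']) a (P := P) (fun _ _ _ => measureReal_nonneg)
    (fun i => by
      simp only [hPsum]
      exact sum_prod_eq_one (fun (j : Fin ℓ) b => W.prob (x (i * ℓ + j)) b)
        fun j => W.sum_eq_one _)
    hScard (Nat.mul_pos hs (pow_pos hM d))
    (fun i y v hne => by
      by_contra hv
      apply hne
      have : ({ω | VB i ω = v} ∩ {ω | YB i ω = y}) = ∅ := by
        ext ω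
        simp only [Set.mem_inter_iff, Set.mem_ofPred_eq, Set.mem_empty_iff_false, iff_false]
        rintro ⟨rfl, rfl⟩
        exact hv (hSmem i i.2 ω)
      simp only [P, this, measureReal_empty])
    (Q := fun y => ∏ j, p (y j)) (fun y => Finset.prod_nonneg fun j _ => hp0 _)
    (sum_prod_eq_one (fun _ : Fin ℓ => p) fun _ => hp1)
    (fun i y v _ hne => by
      have h1 : ∑ v, P i y v ≠ 0 := fun h0 => hne
        ((Finset.sum_eq_zero_iff_of_nonneg fun _ _ => measureReal_nonneg).mp h0 v
          (Finset.mem_univ v))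
      rw [hPsum] at h1
      exact Finset.prod_ne_zero_iff.mpr fun j hj =>
        hac i j _ (Finset.prod_ne_zero_iff.mp h1 j hj))
    (Nat.one_le_pow _ _ hJ) hsupp hε0 hε1 herr
  have hcap : ∑ i : Fin N, 1 / (N : ℝ) * ∑ y, (∑ v, P i y v) *
      (Real.log (∑ v, P i y v) - Real.log (∏ j, p (y j))) ≤ ℓ * (W.capacity * Real.log 2) := by
    have h1 := W.sum_mul_log_sub_log_le_capacity
      (π := fun _ : Fin N × Fin ℓ => 1 / ((N : ℝ) * ℓ)) (fun _ => by positivity) hκ1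
      fun k => x (k.1 * ℓ + k.2)
    refine le_trans (le_of_eq ?_) (mul_le_mul_of_nonneg_left h1 (Nat.cast_nonneg ℓ))
    rw [Fintype.sum_prod_type, Finset.mul_sum]
    refine Finset.sum_congr rfl fun i _ => ?_
    simp only [hPsum]
    rw [sum_prod_mul_log_sub_log (fun (j : Fin ℓ) b => W.prob (x (i * ℓ + j)) b)
      (fun j => W.sum_eq_one _) p (hac i), ← Finset.mul_sum, ← mul_assoc]
    congr 1
    field_simp
  have h1 : mapDist q (empDist ℓ (N * ℓ) u) = mapDist a (fun _ => 1 / (N : ℝ)) := by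
    rw [empDist_eq_mapDist hℓ, mapDist_mapDist]; rfl
  -- Multiplying by `log 2` passes from bits to nats.
  rw [← mul_le_mul_iff_left₀ hlog, entropyBits_mul_log_two, h1]
  refine hmain.trans ?_
  have hlogk : Real.log ((Fintype.card 𝒵 * Fintype.card 𝒱 ^ d : ℕ) : ℝ)
      = Real.log (Fintype.card 𝒵) + d * Real.log (Fintype.card 𝒱) := by
    push_cast
    rw [Real.log_mul (by positivity) (by positivity), Real.log_pow]
  have h3 : Real.log ((Fintype.card 𝒰 ^ ℓ : ℕ) : ℝ) = ℓ * Real.log (Fintype.card 𝒰) := by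
    push_cast
    rw [Real.log_pow]
  have h4 : (ℓ * W.capacity + Real.logb 2 (Fintype.card 𝒵) + d * Real.logb 2 (Fintype.card 𝒱)
      + bigDelta (Fintype.card 𝒰) ℓ ε) * Real.log 2
      = ℓ * (W.capacity * Real.log 2) + Real.log (Fintype.card 𝒵)
        + d * Real.log (Fintype.card 𝒱) + (Real.binEntropy ε
          + ε * (ℓ * Real.log (Fintype.card 𝒰))) := by
    simp only [bigDelta, h2, Real.logb]
    field_simp
  rw [h4, hlogk, h3]
  linarith

theorem bigDelta_nonneg {J ℓ : ℕ} {ε : ℝ} (h0 : 0 ≤ ε) (h1 : ε ≤ 1) : 0 ≤ bigDelta J ℓ ε :=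
  add_nonneg (div_nonneg (Real.binEntropy_nonneg h0 h1) (Real.log_nonneg one_le_two))
    (mul_nonneg (mul_nonneg h0 (Nat.cast_nonneg ℓ))
      (div_nonneg (Real.log_natCast_nonneg J) (Real.log_nonneg one_le_two)))

theorem logb_two_natCast_nonneg (m : ℕ) : 0 ≤ Real.logb 2 (m : ℝ) :=
  div_nonneg (Real.log_natCast_nonneg m) (Real.log_nonneg one_le_two)

/-- At `n = 1` the divisor `log n` vanishes, and division by zero gives the intended value `0`. -/
theorem delta2_nonneg {J K L ℓ n : ℕ} {r η : ℕ → ℝ} (hr : 0 ≤ r n) (hη : η n < 1) :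
    0 ≤ delta2 J K L ℓ n r η := by
  have hJ := logb_two_natCast_nonneg J
  have hL := logb_two_natCast_nonneg L
  have hn := logb_two_natCast_nonneg n
  have he : 0 ≤ Real.logb 2 (Real.exp 1) :=
    Real.logb_nonneg one_lt_two (Real.one_le_exp zero_le_one)
  have hη' : 0 < 1 - η n := by linarith
  unfold delta2 delta1
  positivity

/-! ### From the entropy bound to distortion. -/

theorem le_rhoMax {𝒰 𝒱 : Type*} [Finite 𝒰] [Finite 𝒱] (ρ : 𝒰 → 𝒱 → ℝ) (a : 𝒰) (v : 𝒱) :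
    ρ a v ≤ rhoMax ρ :=
  le_ciSup (f := fun p : 𝒰 × 𝒱 => ρ p.1 p.2) (Set.finite_range _).bddAbove (a, v)

theorem Dtilde_le {𝒰 𝒱 : Type*} [Fintype 𝒰] [Fintype 𝒱] {ρ : 𝒰 → 𝒱 → ℝ}
    (hρ : ∀ a v, 0 ≤ ρ a v) {ℓ n : ℕ} {u : ℕ → 𝒰} {R : ℝ} {q : (Fin ℓ → 𝒰) → (Fin ℓ → 𝒱)}
    (hq : entropyBits (mapDist q (empDist ℓ n u)) ≤ ℓ * R) :
    Dtilde ρ ℓ n u R ≤ empDistortion ρ ℓ n u q := by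
  refine csInf_le ⟨0, ?_⟩ ⟨q, hq, rfl⟩
  rintro _ ⟨q', _, rfl⟩
  refine mul_nonneg (by positivity) (Finset.sum_nonneg fun b _ => mul_nonneg ?_
    (Finset.sum_nonneg fun j _ => hρ _ _))
  unfold empDist
  positivity

/-- The expected distortion is at least that of the block map, up to the error probability. -/
theorem empDistortion_sub_le {𝒰 𝒱 Ω : Type*} [Fintype 𝒰] [Fintype 𝒱] [MeasurableSpace Ω]
    {μ : Measure Ω} [IsProbabilityMeasure μ] {ρ : 𝒰 → 𝒱 → ℝ} (hρ : ∀ a v, 0 ≤ ρ a v) {ℓ N : ℕ}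
    [NeZero ℓ] (hN : 0 < N) (u : ℕ → 𝒰) {V : ℕ → Ω → 𝒱}
    (hV : ∀ t < N * ℓ, ∀ v, MeasurableSet {ω | V t ω = v}) (q : (Fin ℓ → 𝒰) → (Fin ℓ → 𝒱))
    {ε : ℝ} (hε : 1 / (N : ℝ) * ∑ i ∈ Finset.range N,
      μ.real {ω | block ℓ (fun t => V t ω) i ≠ q (block ℓ u i)} ≤ ε) :
    empDistortion ρ ℓ (N * ℓ) u q - rhoMax ρ * ε
      ≤ 1 / ((N * ℓ : ℕ) : ℝ) * ∑ t ∈ Finset.range (N * ℓ), ∫ ω, ρ (u t) (V t ω) ∂μ := by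
  classical
  have hℓ : 0 < ℓ := NeZero.pos ℓ
  have hℓ' : (ℓ : ℝ) ≠ 0 := by exact_mod_cast hℓ.ne'
  have hN' : (N : ℝ) ≠ 0 := by exact_mod_cast hN.ne'
  obtain ⟨ω₀⟩ : Nonempty Ω := nonempty_of_isProbabilityMeasure μ
  have hρmax : 0 ≤ rhoMax ρ := (hρ (u 0) (V 0 ω₀)).trans (le_rhoMax ρ _ _)
  let E : Fin N → Set Ω := fun i => {ω | block ℓ (fun t => V t ω) i ≠ q (block ℓ u i)}
  have hlt : ∀ (i : Fin N) (j : Fin ℓ), (i : ℕ) * ℓ + j < N * ℓ := fun i j => by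
    have := i.2; have := j.2; nlinarith
  have hE : ∀ i, MeasurableSet (E i) := fun i =>
    (measurableSet_block (fun j => hV _ (hlt i j)) _).compl
  -- Pointwise, `V` agrees with `q` off `E i`; on `E i` the left integrand is at most zero, since `ρ
  -- ≤ ρ_max`.
  have hterm : ∀ (i : Fin N) (j : Fin ℓ),
      ρ (u (i * ℓ + j)) (q (block ℓ u i) j) - rhoMax ρ * μ.real (E i)
        ≤ ∫ ω, ρ (u (i * ℓ + j)) (V (i * ℓ + j) ω) ∂μ := by
    intro i j
    have hmeas : Measurable fun ω => ρ (u (i * ℓ + j)) (V (i * ℓ + j) ω) := by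
      let _ : MeasurableSpace 𝒱 := ⊤
      have h1 : Measurable (V (i * ℓ + j)) := measurable_to_countable' fun v => hV _ (hlt i j) v
      exact (measurable_of_finite (ρ (u (i * ℓ + j)))).comp h1
    have hint : Integrable (fun ω => ρ (u (i * ℓ + j)) (V (i * ℓ + j) ω)) μ :=
      Integrable.of_bound hmeas.aestronglyMeasurable (rhoMax ρ) (ae_of_all _ fun ω => by
        rw [Real.norm_of_nonneg (hρ _ _)]
        exact le_rhoMax ρ _ _)
    have hind : Integrable ((E i).indicator fun _ => rhoMax ρ) μ :=
      (integrable_const _).indicator (hE i)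
    have h1 : ∫ ω, (ρ (u (i * ℓ + j)) (q (block ℓ u i) j) - (E i).indicator (fun _ => rhoMax ρ) ω)
        ∂μ = ρ (u (i * ℓ + j)) (q (block ℓ u i) j) - rhoMax ρ * μ.real (E i) := by
      rw [integral_sub (integrable_const _) hind, integral_indicator_const _ (hE i)]
      simp [mul_comm]
    rw [← h1]
    refine integral_mono ((integrable_const _).sub hind) hint fun ω => ?_
    by_cases hω : ω ∈ E i
    · simp only [Set.indicator_of_mem hω]
      linarith [le_rhoMax ρ (u (i * ℓ + j)) (q (block ℓ u i) j),
        hρ (u (i * ℓ + j)) (V (i * ℓ + j) ω)]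
    · simp only [Set.indicator_of_notMem hω, sub_zero]
      have : block ℓ (fun t => V t ω) i = q (block ℓ u i) := not_not.mp hω
      rw [← this, block]
  have hsum : ∑ t ∈ Finset.range (N * ℓ), ∫ ω, ρ (u t) (V t ω) ∂μ
      = ∑ i : Fin N, ∑ j : Fin ℓ, ∫ ω, ρ (u (i * ℓ + j)) (V (i * ℓ + j) ω) ∂μ := by
    rw [← Fin.sum_univ_eq_sum_range fun t => ∫ ω, ρ (u t) (V t ω) ∂μ, ← Fintype.sum_prod_type',
      ← finProdFinEquiv.sum_comp]
    refine Finset.sum_congr rfl fun k _ => ?_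
    have : ((finProdFinEquiv k : Fin (N * ℓ)) : ℕ) = k.1 * ℓ + k.2 := by
      rw [finProdFinEquiv_apply_val]; ring
    rw [this]
  have hemp : empDistortion ρ ℓ (N * ℓ) u q = 1 / ((N * ℓ : ℕ) : ℝ) *
      ∑ i : Fin N, ∑ j : Fin ℓ, ρ (u (i * ℓ + j)) (q (block ℓ u i) j) := by
    unfold empDistortion
    rw [empDist_eq_mapDist hℓ, sum_mapDist_mul (fun i : Fin N => block ℓ u i) _
      fun b => ∑ j, ρ (b j) (q b j), ← Finset.mul_sum, ← mul_assoc]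
    push_cast
    congr 1
    field_simp
  have herr : 1 / ((N * ℓ : ℕ) : ℝ) * ∑ i : Fin N, ∑ _j : Fin ℓ, rhoMax ρ * μ.real (E i)
      ≤ rhoMax ρ * ε := by
    refine le_trans (le_of_eq ?_) (mul_le_mul_of_nonneg_left hε hρmax)
    rw [← Fin.sum_univ_eq_sum_range
      fun i => μ.real {ω | block ℓ (fun t => V t ω) i ≠ q (block ℓ u i)}]
    simp only [Finset.sum_const, Finset.card_univ, Fintype.card_fin, nsmul_eq_mul,
      ← Finset.mul_sum]
    push_cast
    field_simp
    rfl
  have hle := mul_le_mul_of_nonneg_left (Finset.sum_le_sum fun i (_ : i ∈ Finset.univ) =>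
    Finset.sum_le_sum fun j (_ : j ∈ Finset.univ) => hterm i j)
    (show (0 : ℝ) ≤ 1 / ((N * ℓ : ℕ) : ℝ) by positivity)
  simp only [Finset.sum_sub_distrib] at hle
  rw [mul_sub] at hle
  rw [hsum, hemp]
  linarith

theorem theorem3 {𝒰 𝒳 𝒴 : Type*} [Fintype 𝒰] [Fintype 𝒳] [Fintype 𝒴] (ℓ : ℕ) [NeZero ℓ] :
    -- the `o(1/√n)` term of `δ₁` depends only on the alphabets of `u`, `x`, `y` and on `ℓ`
    ∃ r : ℕ → ℝ, (∀ n, 0 ≤ r n) ∧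
      r =o[atTop] (fun n : ℕ => 1 / √(n : ℝ)) ∧
      ∀ {𝒱 𝒵 Ω : Type*} [Fintype 𝒱] [Fintype 𝒵] [MeasurableSpace Ω]
        (μ : Measure Ω) [IsProbabilityMeasure μ]
        (ρ : 𝒰 → 𝒱 → ℝ) (_hρ : ∀ a v, 0 ≤ ρ a v)
        (W : DMC 𝒳 𝒴) (u : ℕ → 𝒰) (enc : (ℕ → 𝒰) → ℕ → 𝒳)
        (Y : ℕ → Ω → 𝒴) (_hY : W.IsOutput μ (enc u) Y)
        (dec : FSDecoder 𝒴 𝒱 𝒵 ℓ) (d n : ℕ) (_hn : 0 < n) (_hdvd : ℓ ∣ n)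
        (V : ℕ → Ω → 𝒱) (_hV : dec.IsReconstruction d n Y V)
        (q : (Fin ℓ → 𝒰) → (Fin ℓ → 𝒱)) (ε : ℝ) (_hε0 : 0 ≤ ε) (_hε1 : ε ≤ 1)
        (_hCR : (ℓ : ℝ) / n * ∑ i ∈ Finset.range (n / ℓ),
          μ.real {ω | block ℓ (fun t => V t ω) i ≠ q (block ℓ u i)} ≤ ε)
        (η : ℕ → ℝ) (_hη0 : ∀ m, 0 < η m) (_hη : Tendsto η atTop (nhds 0)) (_hη1 : η n < 1),
        Dtilde (𝒱 := 𝒱) ρ ℓ n u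
            (W.capacity
              + (2 * Real.logb 2 (Fintype.card 𝒵) + d * Real.logb 2 (Fintype.card 𝒱)) / ℓ
              + delta2 (Fintype.card 𝒰) (Fintype.card 𝒳) (Fintype.card 𝒴) ℓ n r η
              + 2 * bigDelta (Fintype.card 𝒰) ℓ ε)
            - rhoMax ρ * ε
          ≤ 1 / (n : ℝ) * ∑ t ∈ Finset.range n, ∫ ω, ρ (u t) (V t ω) ∂μ := by
  -- The argument works with the true law of the channel outputs instead of their empirical law, so
  -- it needs no concentration term: the bound already holds with `r = 0`.
  refine ⟨fun _ => 0, fun _ => le_rfl, Asymptotics.isLittleO_zero _ _, ?_⟩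
  intro 𝒱 𝒵 Ω _ _ _ μ _ ρ hρ W u enc Y hY dec d n hn hdvd V hV q ε hε0 hε1 hCR η _ _ hη1
  obtain ⟨N, rfl⟩ := hdvd
  rw [mul_comm ℓ N] at *
  have hℓ : 0 < ℓ := NeZero.pos ℓ
  have hN : 0 < N := Nat.pos_of_mul_pos_right hn
  have hℓ1 : (1 : ℝ) ≤ ℓ := by exact_mod_cast hℓ
  have hε : 1 / (N : ℝ) * ∑ i ∈ Finset.range N,
      μ.real {ω | block ℓ (fun t => V t ω) i ≠ q (block ℓ u i)} ≤ ε := by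
    rw [Nat.mul_div_cancel _ hℓ] at hCR
    refine le_trans (le_of_eq ?_) hCR
    congr 1
    push_cast
    field_simp
  refine le_trans (sub_le_sub_right (Dtilde_le hρ (q := q) ?_) _)
    (empDistortion_sub_le hρ hN u hV.measurable q hε)
  refine (entropyBits_mapDist_block_le μ u hY hN hV q hε0 hε1 hε).trans ?_
  set δ := delta2 (Fintype.card 𝒰) (Fintype.card 𝒳) (Fintype.card 𝒴) ℓ (N * ℓ) (fun _ => 0) η
  have hδ : 0 ≤ δ := delta2_nonneg le_rfl hη1
  have hΔ := bigDelta_nonneg (J := Fintype.card 𝒰) (ℓ := ℓ) hε0 hε1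
  set Δ := bigDelta (Fintype.card 𝒰) ℓ ε
  have hs := logb_two_natCast_nonneg (Fintype.card 𝒵)
  have h1 : (ℓ : ℝ) * (W.capacity + (2 * Real.logb 2 (Fintype.card 𝒵)
      + d * Real.logb 2 (Fintype.card 𝒱)) / ℓ + δ + 2 * Δ)
      = ℓ * W.capacity + 2 * Real.logb 2 (Fintype.card 𝒵) + d * Real.logb 2 (Fintype.card 𝒱)
        + ℓ * δ + ℓ * (2 * Δ) := by
    field_simp
    ring
  rw [h1]
  -- What remains is slack: one spare `log s`, the term `ℓ δ`, and `2 ℓ Δ` in place of `Δ`.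
  have h2 : 0 ≤ (ℓ : ℝ) * δ := by positivity
  have h3 : 2 * Δ ≤ (ℓ : ℝ) * (2 * Δ) := le_mul_of_one_le_left (by positivity) hℓ1
  linarith
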